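/- **Setting.** Let $A,B\subset\mathbb R^m$ be closed sets that are $C^2$ embedded submanifolds (components of different dimensions are allowed). Let $P_A(x)$ denote the set of points of $A$ nearest to $x$, let $R_A=2P_A-\mathrm{Id}$, and let $v(x)=P_B(R_Ax)-P_Ax$, a set of values, with one element wherever the projections are single valued. A *solution* of $\dot x=v(x)$ on an interval is a curve, absolutely continuous on compact subintervals, whose derivative exists and is a value of $v(x(t))$ for almost every $t$. Its $\omega$-limit set $\omega(x)$ is the set of all limits of sequences $x(t_n)$ with $t_n\to\infty$. **Assumptions.** Put $M:=A\cap B$. Assume that $M$ is compact, that $T_xA+T_xB=\mathbb R^m$ for all $x\in M$, and that for some $\theta_0>0$, $\rho>0$, $\kappa<\infty$: * for every $x\in M$ the smallest nonzero principal angle between $T_xA$ and $T_xB$ (read as $\pi/2$ if there is none) lies in $[\theta_0,\pi/2]$; * $A$ and $B$ have reach at least $\rho$ (each point at distance less than $\rho$ from the set has a unique nearest point in it), and their second fundamental forms are bounded by $\kappa$. For $r>0$ let $$\mathcal S_r=\{x\in\mathbb R^m:\ \operatorname{dist}(x,A)\le r,\ \operatorname{dist}(R_Ax,B)\le r\}$$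 (where $R_Ax$ is multivalued, some value of it is required to satisfy the last inequality). **Definition.** Say that there is *no recurrence in* $K\subset\mathbb R^m$ if 1. every solution $x:[0,\infty)\to\mathbb R^m$ with $x(0)\in K$ satisfies $\omega(x)\subseteq M$; 2. no nontrivial periodic orbit (the range of a nonconstant periodic solution on $\mathbb R$) meets $K$; 3. $K$ contains no chaotic invariant set. Here a set $\Lambda$ is invariant if through each of its points there is a solution $\mathbb R\to\Lambda$; a nonempty invariant set $\Lambda$ is chaotic if the flow on $\Lambda$ has sensitive dependence on initial conditions or is chaotic in the sense of Li and Yorke (so chaos in the sense of Devaney or of Auslander–Yorke is included). **Statement (No recurrence in the tube).** (a) There is $\eta>0$ such that for all $r\in(0,\rho]$ there is no recurrence in the part $\{x\in\mathcal S_r:\operatorname{dist}(x,M)\le\eta\}$ of $\mathcal S_r$ near $M$ (this part is empty if $M=\emptyset$). (b) If $\mathcal S_{r}$ is bounded for some $r>0$ (for instance, if $A$ or $B$ is compact), then there is $r_0\in(0,\rho]$ such that for all $r\in(0,r_0]$ there is no recurrence in $\mathcal S_r$. -/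

import Mathlib

open Set Filter Topology

noncomputable section

namespace RRR

/-- The Euclidean space `ℝ^m`. -/
abbrev E (m : ℕ) : Type := EuclideanSpace ℝ (Fin m)

variable {m : ℕ}

/-! ### Geometry of the constraint sets -/

/-- `A` is a `C²` embedded submanifold of `ℝ^m`: near each of its points it is the zero set of a
`C²` submersion. The codimension `k` may vary with the point (it is locally constant), so that
different connected components may have different dimensions. -/
def IsC2Submanifold (A : Set (E m)) : Prop :=
  ∀ x ∈ A, ∃ (k : ℕ) (f : E m → E k), ContDiffAt ℝ 2 f x ∧
    Function.Surjective (fderiv ℝ f x) ∧ ∀ᶠ y in 𝓝 x, (y ∈ A ↔ f y = 0)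

/-- The tangent space `T_x A`, as a linear subspace of `ℝ^m`. For a submanifold the tangent cone
is already a linear subspace, and the span changes nothing. -/
def tangentSpace (A : Set (E m)) (x : E m) : Submodule ℝ (E m) :=
  Submodule.span ℝ (tangentConeAt ℝ A x)

/-- The smallest nonzero principal angle between two linear subspaces, i.e. the infimum of the
angles between nonzero vectors of the two subspaces that are orthogonal to their intersection.
It lies in `[0, π/2]`, and it is `π/2` if there is no nonzero principal angle. -/
def principalAngle (U W : Submodule ℝ (E m)) : ℝ :=
  sInf (insert (Real.pi / 2)
    {θ : ℝ | ∃ u ∈ U ⊓ (U ⊓ W)ᗮ, ∃ w ∈ W ⊓ (U ⊓ W)ᗮ,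
      u ≠ 0 ∧ w ≠ 0 ∧ θ = InnerProductGeometry.angle u w})

/-- The (possibly empty, possibly multivalued) metric projection: the set of points of `A` that
are nearest to `x`. -/
def proj (A : Set (E m)) (x : E m) : Set (E m) :=
  {a | a ∈ A ∧ ∀ a' ∈ A, dist x a ≤ dist x a'}

/-- `A` has reach at least `ρ`: every point at distance less than `ρ` from `A` has exactly one
nearest point in `A`. -/
def HasReachAtLeast (A : Set (E m)) (ρ : ℝ) : Prop :=
  ∀ x ∈ Metric.thickening ρ A, ∃! a, a ∈ proj A x

/-- The second fundamental form `II` of `A` is bounded by `κ`: `‖II_x(u, u)‖ ≤ κ ‖u‖²` for all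
`x ∈ A` and `u ∈ T_x A`. Here `II_x(u, u)` is the normal component of the acceleration at time `0`
of any `C²` curve in `A` that passes through `x` with velocity `u`. As `II_x` is symmetric, its
norm as a quadratic and as a bilinear form coincide. -/
def SecondFundamentalFormBoundedBy (A : Set (E m)) (κ : ℝ) : Prop :=
  ∀ γ : ℝ → E m, ContDiffAt ℝ 2 γ 0 → (∀ᶠ t in 𝓝 0, γ t ∈ A) →
    ‖((tangentSpace A (γ 0))ᗮ).starProjection (deriv (deriv γ) 0)‖ ≤ κ * ‖deriv γ 0‖ ^ 2

/-! ### The flow -/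

/-- The reflector `R_A = 2 P_A - Id` (multivalued where `P_A` is). -/
def reflect (A : Set (E m)) (x : E m) : Set (E m) :=
  {y | ∃ a ∈ proj A x, y = (2 : ℝ) • a - x}

/-- The flow field `v(x) = P_B (R_A x) - P_A x`, as the set of its values; it is a singleton
wherever the projections involved are single valued. -/
def field (A B : Set (E m)) (x : E m) : Set (E m) :=
  {w | ∃ a ∈ proj A x, ∃ b ∈ proj B ((2 : ℝ) • a - x), w = b - a}

/-- `x` is a Carathéodory solution of `ẋ = v(x)` on the time interval `I`: it is absolutely
continuous on compact subintervals and satisfies the equation at almost every time. -/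
def IsSolutionOn (A B : Set (E m)) (I : Set ℝ) (x : ℝ → E m) : Prop :=
  (∀ s ∈ I, ∀ t ∈ I, AbsolutelyContinuousOnInterval x s t) ∧
    ∀ᵐ t : ℝ, t ∈ I → ∃ w ∈ field A B (x t), HasDerivAt x w t

/-- `S_r = {x | dist (x, A) ≤ r, dist (R_A x, B) ≤ r}`. -/
def tube (A B : Set (E m)) (r : ℝ) : Set (E m) :=
  {x | x ∈ Metric.cthickening r A ∧ ∃ y ∈ reflect A x, y ∈ Metric.cthickening r B}

/-- The `ω`-limit set of a curve: all limits of `x (t_n)` along sequences `t_n → ∞`. -/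
def omegaLimitSet (x : ℝ → E m) : Set (E m) :=
  {p | MapClusterPt p atTop x}

/-- `O` is a nontrivial periodic orbit of the flow: the range of a periodic solution defined for
all times, consisting of more than one point. -/
def IsNontrivialPeriodicOrbit (A B O : Set (E m)) : Prop :=
  ∃ (x : ℝ → E m) (T : ℝ), 0 < T ∧ IsSolutionOn A B univ x ∧ Function.Periodic x T ∧
    O = range x ∧ O.Nontrivial

/-- `x` is a complete solution, defined for all `t ∈ ℝ`, which starts at `p` and stays in `Λ`. -/
def IsOrbitIn (A B Λ : Set (E m)) (p : E m) (x : ℝ → E m) : Prop :=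
  IsSolutionOn A B univ x ∧ x 0 = p ∧ ∀ t, x t ∈ Λ

/-- `Λ` is an invariant set of the flow. -/
def IsInvariantSet (A B Λ : Set (E m)) : Prop :=
  ∀ p ∈ Λ, ∃ x, IsOrbitIn A B Λ p x

/-- Sensitive dependence on initial conditions of the flow on `Λ`. -/
def IsSensitiveOn (A B Λ : Set (E m)) : Prop :=
  ∃ ε > 0, ∀ p ∈ Λ, ∀ δ > 0, ∃ q ∈ Λ, dist p q < δ ∧
    ∃ x y, IsOrbitIn A B Λ p x ∧ IsOrbitIn A B Λ q y ∧ ∃ t ≥ 0, ε < dist (x t) (y t)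

/-- Li–Yorke chaos of the flow on `Λ`: there is an uncountable set any two points of which have
orbits that come arbitrarily close, but do not converge, to each other. -/
def IsLiYorkeChaoticOn (A B Λ : Set (E m)) : Prop :=
  ∃ S ⊆ Λ, ¬ S.Countable ∧ ∀ p ∈ S, ∀ q ∈ S, p ≠ q →
    ∃ x y, IsOrbitIn A B Λ p x ∧ IsOrbitIn A B Λ q y ∧
      (∀ ε > 0, ∃ᶠ t in atTop, dist (x t) (y t) < ε) ∧
      ∃ ε > 0, ∃ᶠ t in atTop, ε < dist (x t) (y t)

/-- `Λ` is a chaotic invariant set, in a weak sense: a nonempty invariant set on which the flow has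
sensitive dependence on initial conditions (as it has if it is chaotic in the sense of Devaney or
of Auslander–Yorke) or is chaotic in the sense of Li and Yorke. -/
def IsChaoticInvariantSet (A B Λ : Set (E m)) : Prop :=
  Λ.Nonempty ∧ IsInvariantSet A B Λ ∧ (IsSensitiveOn A B Λ ∨ IsLiYorkeChaoticOn A B Λ)

/-- No recurrence in the region `K`: every solution that starts in `K` has its `ω`-limit set in
`A ∩ B`, no nontrivial periodic orbit meets `K`, and `K` contains no chaotic invariant set. -/
def NoRecurrenceIn (A B K : Set (E m)) : Prop :=
  (∀ x : ℝ → E m, IsSolutionOn A B (Ici 0) x → x 0 ∈ K → omegaLimitSet x ⊆ A ∩ B) ∧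
  (∀ O : Set (E m), IsNontrivialPeriodicOrbit A B O → Disjoint O K) ∧
  (∀ Λ : Set (E m), Λ ⊆ K → ¬ IsChaoticInvariantSet A B Λ)

end RRR

end

/-!
Put `M = A ∩ B`. The squared distance to `M` is a strict Lyapunov function of the flow near `M`: if
`p` is a point of `M` nearest to `x`, then `⟪x - p, v(x)⟫ ≤ -c ‖x - p‖²` for some `c > 0`, uniformly
for all `x` within some distance `η` of `M` (`RRR.exists_isContractingNear`).

For linear subspaces `U`, `W` with `U ⊔ W = ⊤` and `e ⊥ U ⊓ W`, writing `e = u + u'` with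
`u = P_U e` gives `⟪e, P_W (u - u') - u⟫ = -‖P_{Wᗮ} u‖² - ‖P_W u'‖²`, negative unless `e = 0`
(`RRR.inner_starProjection_reflection_lt`). The nonlinear estimate is reduced to this by a blow-up:
if it failed for all constants, one could rescale around the nearest points `p n ∈ M`, at the scale
`dist (x n) (p n) → 0`, and the metric projections to `A`, `B` and `M` would converge to orthogonal
projections to `U`, `W` and `U ⊓ W`, where `U` and `W` are the kernels of the derivatives of local
defining functions (`RRR.IsRegularZeroSetAt.tendsto_inv_smul_proj`). That `p n` is nearest to `x n`
in `M` becomes `e ⊥ U ⊓ W`, and compactness of `M` makes the constants uniform.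

Along a solution the squared distance, cut off at `η²`, is therefore an absolutely continuous
function `g` with `g' ≤ -2cg` below the cut-off and `g' = 0` at it, so that
`g t (1 + 2c(t - s)) ≤ g s` for `s ≤ t` if `g s < η²`
(`RRR.IsContractingNear.truncSqDist_decay`). Forwards in time, solutions that start near `M` converge
to `M`; periodic orbits that come near `M`, and complete orbits that stay near `M`, lie in `M`, where
the field vanishes, and so they are constant. This excludes all kinds of recurrence near `M`.
Finally, if some tube is bounded, then thin tubes lie near `M`
(`RRR.exists_tube_subset_thickening`).
-/

namespace RRR

variable {m : ℕ}

/-! ### Regular zero sets and their blow-ups -/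

/-- Near `p`, the set `A` is the zero set of `f`, and `f` has at `p` a surjective strict derivative
`L`. Neither `p ∈ A` nor `f p = 0` is required. The kernel of `L` plays the role of the tangent
space; only its comparison with `tangentSpace` in `tangentSpace_le` is needed. -/
structure IsRegularZeroSetAt {F : Type*} [NormedAddCommGroup F] [NormedSpace ℝ F]
    (A : Set (E m)) (f : E m → F) (L : E m →L[ℝ] F) (p : E m) : Prop where
  hasStrictFDerivAt : HasStrictFDerivAt f L p
  surjective : Function.Surjective L
  eventually_mem_iff : ∀ᶠ y in 𝓝 p, y ∈ A ↔ f y = 0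

namespace IsRegularZeroSetAt

variable {F G : Type*} [NormedAddCommGroup F] [NormedSpace ℝ F]
  [NormedAddCommGroup G] [NormedSpace ℝ G]
  {A B : Set (E m)} {f : E m → F} {g : E m → G} {L : E m →L[ℝ] F} {L' : E m →L[ℝ] G} {p : E m}

/-- Two regular zero sets with transversal tangent spaces intersect in a regular zero set. -/
lemma inter (hA : IsRegularZeroSetAt A f L p) (hB : IsRegularZeroSetAt B g L' p)
    (h : L.ker ⊔ L'.ker = ⊤) :
    IsRegularZeroSetAt (A ∩ B) (fun y ↦ (f y, g y)) (L.prod L') p where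
  hasStrictFDerivAt := hA.hasStrictFDerivAt.prodMk hB.hasStrictFDerivAt
  surjective := by
    rintro ⟨s, t⟩
    obtain ⟨x, hx⟩ := hA.surjective s
    obtain ⟨y, hy⟩ := hB.surjective t
    have hxy : x - y ∈ L.ker ⊔ L'.ker := h ▸ Submodule.mem_top
    obtain ⟨u, hu, w, hw, huw⟩ := Submodule.mem_sup.1 hxy
    have hu' : L u = 0 := hu
    have hw' : L' w = 0 := hw
    refine ⟨x - u, ?_⟩
    -- `x - u = y + w` solves both linear equations at once
    have e : x - u = y + w := by
      rw [sub_eq_iff_eq_add, add_assoc, add_comm w u, huw]; abel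
    have h1 : L (x - u) = s := by rw [map_sub, hu', hx, sub_zero]
    have h2 : L' (x - u) = t := by rw [e, map_add, hw', hy, add_zero]
    simp only [ContinuousLinearMap.prod_apply, h1, h2]
  eventually_mem_iff := by
    filter_upwards [hA.eventually_mem_iff, hB.eventually_mem_iff] with y h1 h2
    simp [h1, h2]

lemma isLittleO_sub_apply (hA : IsRegularZeroSetAt A f L p) {ι : Type*} {l : Filter ι}
    {a q : ι → E m} (ha : Tendsto a l (𝓝 p)) (hq : Tendsto q l (𝓝 p)) :
    (fun n ↦ f (a n) - f (q n) - L (a n - q n)) =o[l] fun n ↦ a n - q n :=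
  hA.hasStrictFDerivAt.isLittleO.comp_tendsto (ha.prodMk_nhds hq)

lemma eventually_eq_zero (hA : IsRegularZeroSetAt A f L p) {ι : Type*} {l : Filter ι}
    {a : ι → E m} (ha : Tendsto a l (𝓝 p)) (haA : ∀ n, a n ∈ A) : ∀ᶠ n in l, f (a n) = 0 := by
  filter_upwards [ha.eventually hA.eventually_mem_iff] with n hn using hn.1 (haA n)

/-- Equality holds too, but this inclusion suffices to pass transversality on to the kernels. -/
lemma tangentSpace_le (hA : IsRegularZeroSetAt A f L p) (hp : p ∈ A) :
    tangentSpace A p ≤ L.ker := by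
  refine Submodule.span_le.2 fun y hy ↦ ?_
  obtain ⟨ι, l, hl, c, d, hd₀, hds, hcd⟩ := exists_fun_of_mem_tangentConeAt hy
  have hpd : Tendsto (fun n ↦ p + d n) l (𝓝 p) := by simpa using hd₀.const_add p
  have h := hA.isLittleO_sub_apply hpd (tendsto_const_nhds (x := p))
  have hfp : f p = 0 := hA.eventually_mem_iff.self_of_nhds.1 hp
  have h0 : (fun n ↦ L (d n)) =o[l] d := by
    refine (h.congr' (f₂ := fun n ↦ -L (d n)) ?_
      (Eventually.of_forall fun n ↦ add_sub_cancel_left _ _)).of_neg_left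
    filter_upwards [hds, hpd.eventually hA.eventually_mem_iff] with n h1 h2
    simp [h2.1 h1, hfp]
  have h1 : (fun n ↦ c n • L (d n)) =o[l] fun n ↦ c n • d n :=
    (Asymptotics.isBigO_refl c l).smul_isLittleO h0
  have h2 : Tendsto (fun n ↦ c n • L (d n)) l (𝓝 0) :=
    (h1.trans_isBigO (hcd.isBigO_one ℝ)).tendsto_zero_of_tendsto tendsto_const_nhds
  have h3 : Tendsto (fun n ↦ c n • L (d n)) l (𝓝 (L y)) := by
    simpa [Function.comp_def] using (L.continuous.tendsto y).comp hcd
  exact tendsto_nhds_unique h3 h2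

/-- Every vector `u` of the kernel is tangent to `A` uniformly near `p`: for base points `q n ∈ A`
that tend to `p` and scales `t n → 0` there are points of `A` at `q n + t n • u + o(t n)`. They are
found by correcting `q n + t n • u` with the quantitative open mapping property of `f`. -/
lemma exists_tendsto_inv_smul [CompleteSpace F] (hA : IsRegularZeroSetAt A f L p)
    {ι : Type*} {l : Filter ι}
    {q : ι → E m} {t : ι → ℝ} (hqA : ∀ n, q n ∈ A) (hq : Tendsto q l (𝓝 p))
    (ht : Tendsto t l (𝓝 0)) (ht0 : ∀ n, 0 < t n) {u : E m} (hu : L u = 0) :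
    ∃ a : ι → E m, (∀ᶠ n in l, a n ∈ A) ∧ Tendsto (fun n ↦ (t n)⁻¹ • (a n - q n)) l (𝓝 u) := by
  have hr : L.range = ⊤ := LinearMap.range_eq_top.2 hA.surjective
  set R := L.nonlinearRightInverseOfSurjective hr
  have hN : 0 < R.nnnorm := L.nonlinearRightInverseOfSurjective_nnnorm_pos hr
  obtain ⟨s, hs, hfs⟩ := hA.hasStrictFDerivAt.approximates_deriv_on_nhds
    (c := R.nnnorm⁻¹ / 2) (Or.inr (by positivity))
  set b : ι → E m := fun n ↦ q n + t n • u with hb_def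
  have hb : Tendsto b l (𝓝 p) := by
    simpa using hq.add (ht.smul_const u)
  have hfb : (fun n ↦ f (b n)) =o[l] t := by
    have h := hA.isLittleO_sub_apply hb hq
    refine (h.congr' (f₂ := fun n ↦ f (b n)) (g₂ := fun n ↦ t n • u) ?_
      (Eventually.of_forall fun n ↦ by simp [hb_def])).trans_isBigO ?_
    · filter_upwards [hA.eventually_eq_zero hq hqA] with n hn
      simp [hb_def, hn, hu]
    · refine Asymptotics.IsBigO.of_bound ‖u‖ (Eventually.of_forall fun n ↦ ?_)
      rw [norm_smul, mul_comm]
  set r : ι → ℝ := fun n ↦ 2 * R.nnnorm * ‖f (b n)‖ with hr_def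
  have hrt : r =o[l] t := hfb.norm_left.const_mul_left _
  have hr0 : Tendsto r l (𝓝 0) := hrt.trans_tendsto ht
  obtain ⟨ε, hε, hεs⟩ := Metric.mem_nhds_iff.1 (inter_mem hs hA.eventually_mem_iff)
  have key : ∀ᶠ n in l, ∃ a ∈ A, dist a (b n) ≤ r n := by
    filter_upwards [hb.eventually (Metric.ball_mem_nhds p (half_pos hε)),
      hr0.eventually (gt_mem_nhds (half_pos hε))] with n h1 h2
    have hball : Metric.closedBall (b n) (r n) ⊆ Metric.ball p ε := fun y hy ↦ by
      have := dist_triangle y (b n) p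
      rw [Metric.mem_closedBall] at hy
      rw [Metric.mem_ball]
      linarith
    have hsurj := hfs.surjOn_closedBall_of_nonlinearRightInverse R (ε := r n) (b := b n)
      (by positivity) (fun y hy ↦ (hεs (hball hy)).1)
    have h0 : (0 : F) ∈ Metric.closedBall (f (b n))
        (((R.nnnorm : ℝ)⁻¹ - ((R.nnnorm⁻¹ / 2 : NNReal) : ℝ)) * r n) := by
      rw [mem_closedBall_iff_norm, zero_sub, norm_neg]
      have : (R.nnnorm : ℝ) ≠ 0 := by positivity
      -- `r n` is chosen so that the radius of this ball is exactly `‖f (b n)‖`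
      refine le_of_eq ?_
      simp only [hr_def]
      push_cast
      field_simp
      ring
    obtain ⟨a, ha, hfa⟩ := hsurj h0
    exact ⟨a, (hεs (hball ha)).2.2 hfa, ha⟩
  choose! a haA har using fun n (h : ∃ a ∈ A, dist a (b n) ≤ r n) ↦ h
  refine ⟨a, key.mono haA, ?_⟩
  have hab : (fun n ↦ a n - b n) =o[l] t :=
    (Asymptotics.IsBigO.of_bound 1 (key.mono fun n hn ↦ by
      have := har n hn
      rw [dist_eq_norm] at this
      rw [one_mul]
      exact this.trans (le_abs_self _))).trans_isLittleO hrt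
  refine (by simpa using hab.tendsto_inv_smul_nhds_zero.add_const u :
    Tendsto (fun n ↦ (t n)⁻¹ • (a n - b n) + u) l (𝓝 u)).congr fun n ↦ ?_
  have e : a n - q n = (a n - b n) + t n • u := by simp only [hb_def]; abel
  rw [e, smul_add, inv_smul_smul₀ (ht0 n).ne']

/-- Blow-up of the metric projection: seen from base points `q n ∈ A` that tend to `p` and at the
scale `t n → 0`, a nearest point of `A` becomes the orthogonal projection to the kernel of `L`. The
limit is taken along an ultrafilter, so that bounded sequences converge without passing to
subsequences. -/
lemma tendsto_inv_smul_proj [CompleteSpace F] (hA : IsRegularZeroSetAt A f L p)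
    {ι : Type*} {l : Ultrafilter ι} {a q y : ι → E m} {t : ι → ℝ} {z : E m}
    (hqA : ∀ n, q n ∈ A) (hq : Tendsto q l (𝓝 p))
    (ht : Tendsto t l (𝓝 0)) (ht0 : ∀ n, 0 < t n)
    (hy : Tendsto (fun n ↦ (t n)⁻¹ • (y n - q n)) l (𝓝 z)) (ha : ∀ n, a n ∈ proj A (y n)) :
    Tendsto (fun n ↦ (t n)⁻¹ • (a n - q n)) l (𝓝 (L.ker.starProjection z)) := by
  set α : ι → E m := fun n ↦ (t n)⁻¹ • (a n - q n) with hα_def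
  have hαn : ∀ n, a n - q n = t n • α n := fun n ↦ (smul_inv_smul₀ (ht0 n).ne' _).symm
  -- the rescaled points are bounded, hence converge along the ultrafilter
  obtain ⟨α₀, hα⟩ : ∃ α₀, Tendsto α l (𝓝 α₀) := by
    have hbd : ∀ᶠ n in (l : Filter ι), α n ∈ Metric.closedBall (0 : E m) (2 * (‖z‖ + 1)) := by
      filter_upwards [hy.norm.eventually (gt_mem_nhds (lt_add_one ‖z‖))] with n hn
      rw [mem_closedBall_zero_iff]
      have h1 : ‖a n - q n‖ ≤ 2 * ‖y n - q n‖ := by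
        have h2 := (ha n).2 (q n) (hqA n)
        have h3 := dist_triangle_left (a n) (q n) (y n)
        rw [dist_eq_norm, dist_eq_norm, dist_eq_norm] at h3
        rw [dist_eq_norm, dist_eq_norm] at h2
        linarith
      have h4 := mul_le_mul_of_nonneg_left h1 (inv_nonneg.2 (ht0 n).le)
      have h5 : ‖α n‖ = (t n)⁻¹ * ‖a n - q n‖ := by
        rw [hα_def, norm_smul, Real.norm_of_nonneg (inv_nonneg.2 (ht0 n).le)]
      have h6 : ‖(t n)⁻¹ • (y n - q n)‖ = (t n)⁻¹ * ‖y n - q n‖ := by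
        rw [norm_smul, Real.norm_of_nonneg (inv_nonneg.2 (ht0 n).le)]
      rw [h6] at hn
      rw [h5]
      linarith
    obtain ⟨α₀, -, h⟩ := (isCompact_closedBall (0 : E m) (2 * (‖z‖ + 1))).ultrafilter_le_nhds'
      (l.map α) hbd
    exact ⟨α₀, h⟩
  have hap : Tendsto a l (𝓝 p) := by
    have := hq.add (ht.smul hα)
    simp only [zero_smul, add_zero] at this
    exact this.congr fun n ↦ by rw [← hαn, add_sub_cancel]
  -- the limit is tangent to `A`
  have hαL : L α₀ = 0 := by
    have h := hA.isLittleO_sub_apply hap hq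
    have h0 : (fun n ↦ L (a n - q n)) =o[(l : Filter ι)] t := by
      refine (h.congr' (f₂ := fun n ↦ -L (a n - q n)) (g₂ := fun n ↦ t n • α n) ?_
        (Eventually.of_forall hαn)).of_neg_left.trans_isBigO ?_
      · filter_upwards [hA.eventually_eq_zero hq hqA,
          hA.eventually_eq_zero hap fun n ↦ (ha n).1] with n h1 h2
        simp [h1, h2]
      · simpa using (Asymptotics.isBigO_refl t (l : Filter ι)).smul (hα.isBigO_one ℝ)
    have h1 := h0.tendsto_inv_smul_nhds_zero
    refine tendsto_nhds_unique ((L.continuous.tendsto α₀).comp hα) (h1.congr fun n ↦ ?_)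
    simp [hα_def]
  -- the limit is at least as close to `z` as any tangent vector
  have hmin : ∀ u, L u = 0 → ‖z - α₀‖ ≤ ‖z - u‖ := fun u hu ↦ by
    obtain ⟨b, hbA, hb⟩ := hA.exists_tendsto_inv_smul hqA hq ht ht0 hu
    refine le_of_tendsto_of_tendsto (hy.sub hα).norm (hy.sub hb).norm ?_
    filter_upwards [hbA] with n hn
    have h1 := (ha n).2 (b n) hn
    rw [dist_eq_norm, dist_eq_norm] at h1
    rw [← smul_sub, ← smul_sub, sub_sub_sub_cancel_right, sub_sub_sub_cancel_right, norm_smul,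
      norm_smul]
    gcongr
  have hα₀ : α₀ = L.ker.starProjection z := by
    set u := L.ker.starProjection z
    have huU : u ∈ L.ker := Submodule.starProjection_apply_mem _ _
    have h1 := hmin u huU
    have h2 : inner ℝ (z - u) (u - α₀) = 0 :=
      Submodule.starProjection_inner_eq_zero z _ (L.ker.sub_mem huU hαL)
    have h3 := norm_add_sq_real (z - u) (u - α₀)
    rw [h2, sub_add_sub_cancel] at h3
    have h4 : ‖u - α₀‖ = 0 := by
      have := pow_le_pow_left₀ (norm_nonneg _) h1 2
      have := sq_nonneg ‖u - α₀‖
      exact pow_eq_zero_iff two_ne_zero |>.1 (by linarith)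
    exact (sub_eq_zero.1 (norm_eq_zero.1 h4)).symm
  rwa [hα₀] at hα

end IsRegularZeroSetAt

lemma IsC2Submanifold.exists_isRegularZeroSetAt {A : Set (E m)} (hA : IsC2Submanifold A)
    {p : E m} (hp : p ∈ A) :
    ∃ (k : ℕ) (f : E m → E k) (L : E m →L[ℝ] E k), IsRegularZeroSetAt A f L p := by
  obtain ⟨k, f, hf, hL, h⟩ := hA p hp
  exact ⟨k, f, fderiv ℝ f p, hf.hasStrictFDerivAt two_ne_zero, hL, h⟩

/-! ### The linear case -/

/-- With `u = P_U e` and `u' = e - u` the left side is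
`‖P_W u‖² - ‖P_W u'‖² - ‖u‖² = -‖P_{Wᗮ} u‖² - ‖P_W u'‖²`. It vanishes only if `u ∈ U ⊓ W` and
`u' ∈ (U ⊔ W)ᗮ = ⊥`, that is, if `e ∈ U ⊓ W`. -/
lemma inner_starProjection_reflection_lt {H : Type*} [NormedAddCommGroup H]
    [InnerProductSpace ℝ H] [FiniteDimensional ℝ H] {U W : Submodule ℝ H} (hUW : U ⊔ W = ⊤)
    {e : H} (he : e ∈ (U ⊓ W)ᗮ) (he0 : e ≠ 0) :
    inner ℝ e (W.starProjection ((2 : ℝ) • U.starProjection e - e) - U.starProjection e) < 0 := by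
  set u := U.starProjection e with hu_def
  set u' := e - u with hu'_def
  have huU : u ∈ U := Submodule.starProjection_apply_mem _ _
  have hu' : u' ∈ Uᗮ := Submodule.sub_starProjection_mem_orthogonal _
  have he_eq : e = u + u' := by simp [hu'_def]
  have hz : (2 : ℝ) • u - e = u - u' := by rw [he_eq, two_smul]; abel
  clear_value u u'
  have hsym : ∀ x y : H, inner ℝ x (W.starProjection y) =
      inner ℝ (W.starProjection x) (W.starProjection y) := fun x y ↦ by
    rw [Submodule.inner_starProjection_left_eq_right,
      Submodule.starProjection_eq_self_iff.2 (Submodule.starProjection_apply_mem W y)]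
  have h1 : inner ℝ e u = ‖u‖ ^ 2 := by
    rw [he_eq, inner_add_left, real_inner_self_eq_norm_sq,
      Submodule.inner_left_of_mem_orthogonal huU hu', add_zero]
  have h2 : inner ℝ e (W.starProjection (u - u')) =
      ‖W.starProjection u‖ ^ 2 - ‖W.starProjection u'‖ ^ 2 := by
    rw [hsym, he_eq, map_add, map_sub, inner_add_left, inner_sub_right, inner_sub_right,
      real_inner_comm (W.starProjection u) (W.starProjection u'), real_inner_self_eq_norm_sq,
      real_inner_self_eq_norm_sq]
    ring
  have h3 := Submodule.norm_sq_eq_add_norm_sq_starProjection u W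
  rw [hz, inner_sub_right, h1, h2]
  by_contra! hcon
  have h4 := sq_nonneg ‖W.starProjection u'‖
  have h5 := sq_nonneg ‖Wᗮ.starProjection u‖
  -- equality forces `u ∈ W` and `u' ∈ Wᗮ`
  have h6 : W.starProjection u' = 0 :=
    norm_eq_zero.1 (pow_eq_zero_iff two_ne_zero |>.1 (by linarith))
  have h7 : Wᗮ.starProjection u = 0 :=
    norm_eq_zero.1 (pow_eq_zero_iff two_ne_zero |>.1 (by linarith))
  have huW : u ∈ W := by
    rw [Submodule.starProjection_orthogonal_val, sub_eq_zero] at h7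
    rw [h7]
    exact Submodule.starProjection_apply_mem _ _
  have hu'W : u' ∈ Wᗮ := (Submodule.starProjection_apply_eq_zero_iff W).1 h6
  have hu'0 : u' = 0 := by
    have : u' ∈ (U ⊔ W)ᗮ := by
      rw [← Submodule.inf_orthogonal]
      exact ⟨hu', hu'W⟩
    simpa [hUW] using this
  have heUW : e ∈ U ⊓ W := by
    rw [he_eq, hu'0, add_zero]
    exact ⟨huU, huW⟩
  have hee : inner ℝ e e = 0 := Submodule.inner_right_of_mem_orthogonal heUW he
  exact he0 (inner_self_eq_zero.1 hee)

/-! ### Contraction near the intersection -/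

/-- Within distance `η` of `A ∩ B` the squared distance to `A ∩ B` decreases along the field at an
exponential rate of at least `2 * c`. Instead of its derivative, which need not exist, the
derivative of the squared distance to a nearest point `p` is estimated. -/
def IsContractingNear (A B : Set (E m)) (η c : ℝ) : Prop :=
  ∀ x p w, p ∈ proj (A ∩ B) x → dist x p ≤ η → w ∈ field A B x →
    inner ℝ (x - p) w ≤ -(c * dist x p ^ 2)

/-- If the estimate failed for all constants, a blow-up at the points of failure would violate the
linear case `inner_starProjection_reflection_lt`. -/
lemma exists_isContractingNear {A B : Set (E m)} (hA : IsC2Submanifold A) (hB : IsC2Submanifold B)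
    (h_transversal : ∀ x ∈ A ∩ B, tangentSpace A x ⊔ tangentSpace B x = ⊤)
    (hM : IsCompact (A ∩ B)) :
    ∃ η > 0, ∃ c > 0, IsContractingNear A B η c := by
  unfold IsContractingNear
  by_contra! hcon
  have hpos : ∀ n : ℕ, (0 : ℝ) < 1 / (n + 1) := fun n ↦ Nat.one_div_pos_of_nat
  choose x p w hp hd hw hlt using fun n : ℕ ↦ hcon (1 / (n + 1)) (hpos n) (1 / (n + 1)) (hpos n)
  choose a ha b hb hwab using hw
  set t : ℕ → ℝ := fun n ↦ dist (x n) (p n) with ht_def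
  have ht0 : ∀ n, 0 < t n := fun n ↦ by
    refine dist_pos.2 fun h ↦ ?_
    have := hlt n
    simp [h] at this
  let l : Ultrafilter ℕ := hyperfilter ℕ
  have hl : (l : Filter ℕ) ≤ atTop := Nat.hyperfilter_le_atTop
  have hinv : Tendsto (fun n : ℕ ↦ (1 : ℝ) / (n + 1)) l (𝓝 0) :=
    tendsto_one_div_add_atTop_nhds_zero_nat.mono_left hl
  have ht : Tendsto t l (𝓝 0) := squeeze_zero (fun n ↦ (ht0 n).le) hd hinv
  obtain ⟨q, hqM, hq⟩ : ∃ q ∈ A ∩ B, Tendsto p l (𝓝 q) :=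
    hM.ultrafilter_le_nhds' (l.map p) (Eventually.of_forall (f := (l : Filter ℕ)) fun n ↦ (hp n).1)
  obtain ⟨e, he1, he⟩ : ∃ e ∈ Metric.sphere (0 : E m) 1,
      Tendsto (fun n ↦ (t n)⁻¹ • (x n - p n)) l (𝓝 e) := by
    refine (isCompact_sphere (0 : E m) 1).ultrafilter_le_nhds'
      (l.map fun n ↦ (t n)⁻¹ • (x n - p n)) (Eventually.of_forall (f := (l : Filter ℕ)) fun n ↦ ?_)
    rw [mem_sphere_zero_iff_norm, norm_smul, Real.norm_of_nonneg (inv_nonneg.2 (ht0 n).le),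
      ← dist_eq_norm, inv_mul_cancel₀ (ht0 n).ne']
  have he0 : e ≠ 0 := by
    rintro rfl
    simp at he1
  obtain ⟨k, f, L, hfL⟩ := hA.exists_isRegularZeroSetAt hqM.1
  obtain ⟨k', g, L', hgL⟩ := hB.exists_isRegularZeroSetAt hqM.2
  have hLL : L.ker ⊔ L'.ker = ⊤ := top_le_iff.1 <| (h_transversal q hqM).symm.le.trans
    (sup_le_sup (hfL.tangentSpace_le hqM.1) (hgL.tangentSpace_le hqM.2))
  -- the blow-up limits of `a n ∈ P_A (x n)` and of `b n ∈ P_B (2 a n - x n)`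
  have hα := hfL.tendsto_inv_smul_proj (fun n ↦ (hp n).1.1) hq ht ht0 he ha
  have hy : Tendsto (fun n ↦ (t n)⁻¹ • ((2 : ℝ) • a n - x n - p n)) l
      (𝓝 ((2 : ℝ) • L.ker.starProjection e - e)) := by
    refine ((hα.const_smul (2 : ℝ)).sub he).congr fun n ↦ ?_
    rw [smul_comm, ← smul_sub]
    congr 1
    rw [smul_sub, two_smul ℝ (p n)]
    abel
  have hβ := hgL.tendsto_inv_smul_proj (fun n ↦ (hp n).1.2) hq ht ht0 hy hb
  -- `p n` is its own blow-up limit as the nearest point of `A ∩ B` to `x n`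
  have hperp : e ∈ (L.ker ⊓ L'.ker)ᗮ := by
    have h := (hfL.inter hgL hLL).tendsto_inv_smul_proj (fun n ↦ (hp n).1) hq ht ht0 he hp
    simp only [sub_self, smul_zero] at h
    have h0 := tendsto_nhds_unique h tendsto_const_nhds
    have hker : (L.prod L').ker = L.ker ⊓ L'.ker := LinearMap.ker_prod _ _
    rw [Submodule.starProjection_apply_eq_zero_iff, hker] at h0
    exact h0
  refine (inner_starProjection_reflection_lt hLL hperp he0).not_ge ?_
  have hlim := he.inner (𝕜 := ℝ) (hβ.sub hα)
  refine le_of_tendsto_of_tendsto' (by simpa only [neg_zero] using hinv.neg) hlim fun n ↦ ?_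
  have h := mul_le_mul_of_nonneg_left (hlt n).le (sq_nonneg (t n)⁻¹)
  rw [← smul_sub, sub_sub_sub_cancel_right, real_inner_smul_left, real_inner_smul_right, ← hwab]
  have ht1 : (t n)⁻¹ ^ 2 * t n ^ 2 = 1 := by rw [← mul_pow, inv_mul_cancel₀ (ht0 n).ne', one_pow]
  calc -(1 / ((n : ℝ) + 1)) = (t n)⁻¹ ^ 2 * -(1 / ((n : ℝ) + 1) * t n ^ 2) := by
        linear_combination (1 / ((n : ℝ) + 1)) * ht1
    _ ≤ (t n)⁻¹ ^ 2 * inner ℝ (x n - p n) (w n) := h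
    _ = _ := by ring

end RRR

/-! ### Absolutely continuous functions -/

namespace AbsolutelyContinuousOnInterval

lemma of_dist_le {X Y : Type*} [PseudoMetricSpace X] [PseudoMetricSpace Y] {f : ℝ → X}
    {g : ℝ → Y} {a b : ℝ} (hf : AbsolutelyContinuousOnInterval f a b)
    (h : ∀ s t, dist (g s) (g t) ≤ dist (f s) (f t)) : AbsolutelyContinuousOnInterval g a b := by
  rw [absolutelyContinuousOnInterval_iff] at hf ⊢
  intro ε hε
  obtain ⟨δ, hδ, H⟩ := hf ε hε
  exact ⟨δ, hδ, fun E hE hEδ ↦ (Finset.sum_le_sum fun i _ ↦ h _ _).trans_lt (H E hE hEδ)⟩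

lemma le_of_ae_deriv_nonpos {f : ℝ → ℝ} {a b : ℝ} (hab : a ≤ b)
    (hf : AbsolutelyContinuousOnInterval f a b) (h : ∀ᵐ t : ℝ, t ∈ Icc a b → deriv f t ≤ 0) :
    f b ≤ f a := by
  have h1 := hf.integral_deriv_eq_sub
  have h2 : ∫ t in a..b, deriv f t ≤ ∫ _ in a..b, (0 : ℝ) :=
    intervalIntegral.integral_mono_ae_restrict hab hf.intervalIntegrable_deriv
      intervalIntegrable_const ((MeasureTheory.ae_restrict_iff' measurableSet_Icc).2 h)
  rw [intervalIntegral.integral_zero] at h2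
  linarith

end AbsolutelyContinuousOnInterval

namespace RRR

variable {m : ℕ} {A B : Set (E m)} {η c : ℝ} {x : ℝ → E m}

/-! ### Decay of the distance along solutions -/

/-- The square of the distance to `M`, cut off at `η ^ 2`. -/
noncomputable def truncSqDist (M : Set (E m)) (η : ℝ) (x : E m) : ℝ :=
  min (Metric.infDist x M) η ^ 2

lemma truncSqDist_nonneg (M : Set (E m)) (η : ℝ) (x : E m) : 0 ≤ truncSqDist M η x := sq_nonneg _

lemma continuous_truncSqDist (M : Set (E m)) (η : ℝ) : Continuous (truncSqDist M η) :=
  ((Metric.continuous_infDist_pt M).min continuous_const).pow 2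

lemma truncSqDist_le (M : Set (E m)) (hη : 0 < η) (x : E m) : truncSqDist M η x ≤ η ^ 2 :=
  pow_le_pow_left₀ (le_min Metric.infDist_nonneg hη.le) (min_le_right _ _) 2

lemma truncSqDist_lt_iff {M : Set (E m)} (hη : 0 < η) {x : E m} :
    truncSqDist M η x < η ^ 2 ↔ Metric.infDist x M < η := by
  rw [truncSqDist, pow_lt_pow_iff_left₀ (le_min Metric.infDist_nonneg hη.le) hη.le two_ne_zero]
  simp

lemma truncSqDist_eq_zero_iff {M : Set (E m)} (hM : IsClosed M) (hM0 : M.Nonempty) (hη : 0 < η)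
    {x : E m} : truncSqDist M η x = 0 ↔ x ∈ M := by
  rw [hM.mem_iff_infDist_zero hM0, truncSqDist, pow_eq_zero_iff two_ne_zero]
  constructor
  · intro h
    rcases min_choice (Metric.infDist x M) η with h' | h' <;> rw [h'] at h
    · exact h
    · exact absurd h hη.ne'
  · intro h
    rw [h, min_eq_left hη.le]

lemma absolutelyContinuousOnInterval_truncSqDist (M : Set (E m)) (η : ℝ) {s t : ℝ}
    (hx : AbsolutelyContinuousOnInterval x s t) :
    AbsolutelyContinuousOnInterval (fun τ ↦ truncSqDist M η (x τ)) s t := by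
  have h : AbsolutelyContinuousOnInterval (fun τ ↦ min (Metric.infDist (x τ) M) η) s t :=
    hx.of_dist_le fun a b ↦ by
      simpa using ((Metric.lipschitz_infDist_pt M).min_const η).dist_le_mul (x a) (x b)
  have e : (fun τ ↦ truncSqDist M η (x τ)) =
      (fun τ ↦ min (Metric.infDist (x τ) M) η) * fun τ ↦ min (Metric.infDist (x τ) M) η :=
    funext fun τ ↦ sq _
  exact e ▸ h.mul h

/-- The derivative of the cut-off squared distance along a solution. Where it has its maximal value
`η ^ 2`, the derivative vanishes; elsewhere it agrees with that of `s ↦ ‖x s - p‖ ^ 2`, which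
touches it from above, for a nearest point `p` at time `τ`. -/
lemma IsContractingNear.deriv_truncSqDist_le (hc : IsContractingNear A B η c)
    (hM : IsCompact (A ∩ B)) (hM0 : (A ∩ B).Nonempty) (hη : 0 < η) {w : E m} {τ : ℝ}
    (hw : w ∈ field A B (x τ)) (hx : HasDerivAt x w τ)
    (hd : DifferentiableAt ℝ (fun s ↦ truncSqDist (A ∩ B) η (x s)) τ) :
    (η ≤ Metric.infDist (x τ) (A ∩ B) → deriv (fun s ↦ truncSqDist (A ∩ B) η (x s)) τ = 0) ∧
    (Metric.infDist (x τ) (A ∩ B) < η → deriv (fun s ↦ truncSqDist (A ∩ B) η (x s)) τ ≤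
      -(2 * c * truncSqDist (A ∩ B) η (x τ))) := by
  refine ⟨fun h ↦ IsLocalMax.deriv_eq_zero (Eventually.of_forall fun s ↦ ?_), fun h ↦ ?_⟩
  · refine (truncSqDist_le _ hη _).trans_eq ?_
    simp only [truncSqDist, min_eq_right h]
  · obtain ⟨p, hpM, hp⟩ := hM.exists_infDist_eq_dist hM0 (x τ)
    have hpp : p ∈ proj (A ∩ B) (x τ) := ⟨hpM, fun q hq ↦ hp ▸ Metric.infDist_le_dist_of_mem hq⟩
    have hin := hc (x τ) p w hpp (hp ▸ h.le) hw
    have hval : truncSqDist (A ∩ B) η (x τ) = dist (x τ) p ^ 2 := by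
      rw [truncSqDist, min_eq_left h.le, hp]
    have hd2 : HasDerivAt (fun s ↦ ‖x s - p‖ ^ 2) (2 * inner ℝ (x τ - p) w) τ :=
      (hx.sub_const p).norm_sq
    have hmax : IsLocalMax (fun s ↦ truncSqDist (A ∩ B) η (x s) - ‖x s - p‖ ^ 2) τ :=
      Eventually.of_forall fun s ↦ by
        have h1 : truncSqDist (A ∩ B) η (x s) ≤ ‖x s - p‖ ^ 2 := by
          rw [← dist_eq_norm]
          exact pow_le_pow_left₀ (le_min Metric.infDist_nonneg hη.le)
            ((min_le_left _ _).trans (Metric.infDist_le_dist_of_mem hpM)) 2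
        simp only [hval, ← dist_eq_norm, sub_self]
        rw [← dist_eq_norm] at h1
        linarith
    have h0 := hmax.hasDerivAt_eq_zero (hd.hasDerivAt.sub hd2)
    rw [hval]
    linarith

/-- Quantitative decay along a solution. It is weaker than exponential decay, but shows both that
the distance tends to `0` forwards in time and that, unless it is `0`, it leaves every bounded
range backwards in time. -/
lemma IsContractingNear.truncSqDist_decay (hc : IsContractingNear A B η c)
    (hM : IsCompact (A ∩ B)) (hM0 : (A ∩ B).Nonempty) (hη : 0 < η) (hc0 : 0 < c) {I : Set ℝ}
    (hI : I.OrdConnected) (hx : IsSolutionOn A B I x) {s t : ℝ} (hs : s ∈ I) (ht : t ∈ I)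
    (hst : s ≤ t) (hxs : Metric.infDist (x s) (A ∩ B) < η) :
    truncSqDist (A ∩ B) η (x t) * (1 + 2 * c * (t - s)) ≤ truncSqDist (A ∩ B) η (x s) := by
  set g : ℝ → ℝ := fun s ↦ truncSqDist (A ∩ B) η (x s) with hg_def
  have hac : ∀ a ∈ I, ∀ b ∈ I, AbsolutelyContinuousOnInterval g a b := fun a ha b hb ↦
    absolutelyContinuousOnInterval_truncSqDist _ _ (hx.1 a ha b hb)
  have hder : ∀ a ∈ I, ∀ b ∈ I, a ≤ b → ∀ᵐ τ : ℝ, τ ∈ Icc a b → DifferentiableAt ℝ g τ ∧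
      (η ≤ Metric.infDist (x τ) (A ∩ B) → deriv g τ = 0) ∧
      (Metric.infDist (x τ) (A ∩ B) < η → deriv g τ ≤ -(2 * c * g τ)) := fun a ha b hb hab ↦ by
    filter_upwards [hx.2, (hac a ha b hb).ae_differentiableAt] with τ h1 h2 hτ
    obtain ⟨w, hw, hxw⟩ := h1 (hI.out ha hb hτ)
    have hd := h2 (by rwa [uIcc_of_le hab])
    exact ⟨hd, hc.deriv_truncSqDist_le hM hM0 hη hw hxw hd⟩
  -- thanks to the cut-off this needs no prior knowledge that the solution stays near `A ∩ B`
  have hanti : ∀ a ∈ I, ∀ b ∈ I, a ≤ b → g b ≤ g a := fun a ha b hb hab ↦ by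
    refine (hac a ha b hb).le_of_ae_deriv_nonpos hab ?_
    filter_upwards [hder a ha b hb hab] with τ h hτ
    obtain ⟨-, h1, h2⟩ := h hτ
    rcases le_or_gt η (Metric.infDist (x τ) (A ∩ B)) with h3 | h3
    · exact (h1 h3).le
    · have := mul_nonneg (mul_nonneg zero_le_two hc0.le) (truncSqDist_nonneg (A ∩ B) η (x τ))
      exact (h2 h3).trans (neg_nonpos.2 this)
  -- as `g` decreases, its slope on `[s, t]` is at most `-2 * c * g t`
  have hlin : AbsolutelyContinuousOnInterval (fun τ ↦ 2 * c * g t * (τ - s)) s t :=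
    ContDiffOn.absolutelyContinuousOnInterval (by fun_prop)
  have key := ((hac s hs t ht).add hlin).le_of_ae_deriv_nonpos hst (by
    filter_upwards [hder s hs t ht hst] with τ h hτ
    obtain ⟨hd, -, h2⟩ := h hτ
    have hτI : τ ∈ I := hI.out hs ht hτ
    have h3 : Metric.infDist (x τ) (A ∩ B) < η := (truncSqDist_lt_iff hη).1
      ((hanti s hs τ hτI hτ.1).trans_lt ((truncSqDist_lt_iff hη).2 hxs))
    have h4 : HasDerivAt (fun τ ↦ 2 * c * g t * (τ - s)) (2 * c * g t * 1) τ :=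
      ((hasDerivAt_id τ).sub_const s).const_mul _
    rw [(hd.hasDerivAt.add h4).deriv]
    have h5 := mul_le_mul_of_nonneg_left (hanti τ hτI t ht hτ.2) (mul_pos two_pos hc0).le
    have h6 := h2 h3
    linarith)
  simp only [Pi.add_apply, sub_self, mul_zero, add_zero] at key
  linarith

/-- The field vanishes on `A ∩ B`, so that a solution which stays there is constant. -/
lemma IsSolutionOn.eq_of_forall_mem_inter (hx : IsSolutionOn A B univ x) (h : ∀ t, x t ∈ A ∩ B)
    (s t : ℝ) : x s = x t := by
  have hproj : ∀ {C : Set (E m)} {y a : E m}, y ∈ C → a ∈ proj C y → a = y := fun hy ha ↦ by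
    have := ha.2 _ hy
    rw [dist_self] at this
    exact (dist_le_zero.1 this).symm
  obtain ⟨C, hC⟩ := (hx.1 s trivial t trivial).const_of_ae_hasDerivAt_zero (by
    filter_upwards [hx.2] with τ hτ _
    obtain ⟨w, ⟨a, ha, b, hb, rfl⟩, hw⟩ := hτ trivial
    obtain rfl := hproj (h τ).1 ha
    rw [two_smul, add_sub_cancel_right] at hb
    rwa [hproj (h τ).2 hb, sub_self] at hw)
  rw [hC s left_mem_uIcc, hC t right_mem_uIcc]

/-! ### No recurrence -/

lemma IsContractingNear.omegaLimitSet_subset (hc : IsContractingNear A B η c)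
    (hM : IsCompact (A ∩ B)) (hM0 : (A ∩ B).Nonempty) (hη : 0 < η) (hc0 : 0 < c)
    (hx : IsSolutionOn A B (Ici 0) x) (hx0 : Metric.infDist (x 0) (A ∩ B) < η) :
    omegaLimitSet x ⊆ A ∩ B := by
  intro p hp
  have hlim : Tendsto (fun t ↦ truncSqDist (A ∩ B) η (x t)) atTop (𝓝 0) := by
    have hden : Tendsto (fun t : ℝ ↦ 1 + 2 * c * t) atTop atTop :=
      tendsto_atTop_add_const_left _ _ (tendsto_id.const_mul_atTop (by positivity))
    refine squeeze_zero' (Eventually.of_forall fun t ↦ truncSqDist_nonneg _ _ _) ?_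
      (hden.const_div_atTop (truncSqDist (A ∩ B) η (x 0)))
    filter_upwards [eventually_ge_atTop 0] with t ht
    have h := hc.truncSqDist_decay hM hM0 hη hc0 ordConnected_Ici hx self_mem_Ici ht ht hx0
    rw [sub_zero] at h
    rwa [le_div_iff₀ (by positivity)]
  have hp' : MapClusterPt (truncSqDist (A ∩ B) η p) atTop (truncSqDist (A ∩ B) η ∘ x) :=
    MapClusterPt.continuousAt_comp (continuous_truncSqDist _ _).continuousAt hp
  exact (truncSqDist_eq_zero_iff hM.isClosed hM0 hη).1 
    (eq_of_nhds_neBot (hp'.neBot.mono (inf_le_inf_left _ hlim)))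

lemma IsContractingNear.disjoint_of_isNontrivialPeriodicOrbit (hc : IsContractingNear A B η c)
    (hM : IsCompact (A ∩ B)) (hM0 : (A ∩ B).Nonempty) (hη : 0 < η) (hc0 : 0 < c)
    {O : Set (E m)} (hO : IsNontrivialPeriodicOrbit A B O) :
    Disjoint O {y | Metric.infDist y (A ∩ B) < η} := by
  obtain ⟨x, T, hT, hx, hper, rfl, hnt⟩ := hO
  rw [Set.disjoint_left]
  rintro _ ⟨t₀, rfl⟩ ht₀
  have hdec : ∀ t, t₀ ≤ t → _ := fun t ht ↦
    hc.truncSqDist_decay hM hM0 hη hc0 ordConnected_univ hx trivial trivial ht ht₀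
  have h0 : truncSqDist (A ∩ B) η (x t₀) = 0 := by
    have h := hdec (t₀ + T) (by linarith)
    rw [hper] at h
    refine le_antisymm ?_ (truncSqDist_nonneg _ _ _)
    by_contra! hlt
    have := mul_pos hlt (mul_pos (mul_pos two_pos hc0) hT)
    linarith
  have hmem : ∀ t, x t ∈ A ∩ B := fun t ↦ by
    rw [← truncSqDist_eq_zero_iff hM.isClosed hM0 hη]
    obtain ⟨n, hn⟩ := exists_nat_ge ((t₀ - t) / T)
    rw [div_le_iff₀ hT] at hn
    have h := hdec (t + n * T) (by linarith)
    rw [hper.nat_mul n, h0] at h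
    have hpos : 0 < 1 + 2 * c * (t + n * T - t₀) := by
      have := mul_nonneg (mul_pos two_pos hc0).le (by linarith : 0 ≤ t + n * T - t₀)
      linarith
    exact le_antisymm (nonpos_of_mul_nonpos_left h hpos) (truncSqDist_nonneg _ _ _)
  obtain ⟨_, ⟨s, rfl⟩, _, ⟨t, rfl⟩, hne⟩ := hnt
  exact hne (hx.eq_of_forall_mem_inter hmem s t)

/-- Complete orbits that stay near `A ∩ B` are fixed points: otherwise the distance to `A ∩ B` would
be unbounded backwards in time. -/
lemma IsContractingNear.orbit_eq (hc : IsContractingNear A B η c)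
    (hM : IsCompact (A ∩ B)) (hM0 : (A ∩ B).Nonempty) (hη : 0 < η) (hc0 : 0 < c)
    {Λ : Set (E m)} (hΛ : Λ ⊆ {y | Metric.infDist y (A ∩ B) < η}) {p : E m}
    (hx : IsOrbitIn A B Λ p x) (t : ℝ) : x t = p := by
  have hmem : ∀ t, x t ∈ A ∩ B := fun t ↦ by
    rw [← truncSqDist_eq_zero_iff hM.isClosed hM0 hη]
    refine le_antisymm ?_ (truncSqDist_nonneg _ _ _)
    by_contra! hlt
    set v := truncSqDist (A ∩ B) η (x t)
    -- the starting time is so early that the value `v` at time `t` would require more than `η ^ 2`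
    have h := hc.truncSqDist_decay hM hM0 hη hc0 ordConnected_univ hx.1
      (s := t - η ^ 2 / (2 * c * v)) (t := t) trivial trivial (sub_le_self _ (by positivity))
      (hΛ (hx.2.2 _))
    have h1 := truncSqDist_le (A ∩ B) hη (x (t - η ^ 2 / (2 * c * v)))
    have h2 : v * (1 + 2 * c * (t - (t - η ^ 2 / (2 * c * v)))) = v + η ^ 2 := by
      field_simp
      ring
    rw [h2] at h
    linarith
  rw [hx.1.eq_of_forall_mem_inter hmem t 0, hx.2.1]

lemma IsContractingNear.not_isChaoticInvariantSet (hc : IsContractingNear A B η c)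
    (hM : IsCompact (A ∩ B)) (hM0 : (A ∩ B).Nonempty) (hη : 0 < η) (hc0 : 0 < c)
    {Λ : Set (E m)} (hΛ : Λ ⊆ {y | Metric.infDist y (A ∩ B) < η}) :
    ¬ IsChaoticInvariantSet A B Λ := by
  rintro ⟨⟨p, hp⟩, -, ⟨ε, hε, h⟩ | ⟨S, -, hS, h⟩⟩
  · obtain ⟨q, -, hpq, x, y, hx, hy, t, -, hxy⟩ := h p hp ε hε
    rw [hc.orbit_eq hM hM0 hη hc0 hΛ hx, hc.orbit_eq hM hM0 hη hc0 hΛ hy] at hxy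
    exact hpq.not_gt hxy
  · have hnt : S.Nontrivial := by
      by_contra hsub
      exact hS (Set.not_nontrivial_iff.1 hsub).countable
    obtain ⟨p, hp, q, hq, hpq⟩ := hnt
    obtain ⟨x, y, hx, hy, h1, ε, hε, h2⟩ := h p hp q hq hpq
    obtain ⟨t, ht⟩ := (h1 ε hε).exists
    obtain ⟨t', ht'⟩ := h2.exists
    simp only [hc.orbit_eq hM hM0 hη hc0 hΛ hx, hc.orbit_eq hM hM0 hη hc0 hΛ hy] at ht ht'
    exact ht.not_gt ht'

lemma NoRecurrenceIn.mono {K K' : Set (E m)} (h : NoRecurrenceIn A B K') (hK : K ⊆ K') :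
    NoRecurrenceIn A B K :=
  ⟨fun x hx hx0 ↦ h.1 x hx (hK hx0), fun O hO ↦ (h.2.1 O hO).mono_right hK,
    fun Λ hΛ ↦ h.2.2 Λ (hΛ.trans hK)⟩

lemma noRecurrenceIn_empty : NoRecurrenceIn A B ∅ :=
  ⟨fun _ _ h ↦ h.elim, fun _ _ ↦ disjoint_empty _, fun _ hΛ h ↦ (hΛ h.1.choose_spec).elim⟩

lemma IsContractingNear.noRecurrenceIn_thickening (hc : IsContractingNear A B η c)
    (hM : IsCompact (A ∩ B)) (hη : 0 < η) (hc0 : 0 < c) :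
    NoRecurrenceIn A B (Metric.thickening η (A ∩ B)) := by
  rcases (A ∩ B).eq_empty_or_nonempty with h0 | h0
  · rw [h0, Metric.thickening_empty]
    exact noRecurrenceIn_empty
  · have : Metric.thickening η (A ∩ B) = {y | Metric.infDist y (A ∩ B) < η} :=
      Set.ext fun y ↦ Metric.mem_thickening_iff_infDist_lt h0
    rw [this]
    exact ⟨fun x hx hx0 ↦ hc.omegaLimitSet_subset hM h0 hη hc0 hx hx0,
      fun O hO ↦ hc.disjoint_of_isNontrivialPeriodicOrbit hM h0 hη hc0 hO,
      fun Λ hΛ ↦ hc.not_isChaoticInvariantSet hM h0 hη hc0 hΛ⟩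

lemma tube_mono (A B : Set (E m)) {r r' : ℝ} (h : r ≤ r') : tube A B r ⊆ tube A B r' :=
  fun _ ⟨h1, y, hy, h2⟩ ↦
    ⟨Metric.cthickening_mono h _ h1, y, hy, Metric.cthickening_mono h _ h2⟩

/-- By compactness, thin tubes lie near `A ∩ B` once some tube is bounded: a limit of points of
tubes whose radii tend to `0` lies in `A` and in `B`. -/
lemma exists_tube_subset_thickening (hA : IsClosed A) (hB : IsClosed B) {r₁ : ℝ} (hr₁ : 0 < r₁)
    (hbd : Bornology.IsBounded (tube A B r₁)) {η : ℝ} (hη : 0 < η) :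
    ∃ r > 0, tube A B r ⊆ Metric.thickening η (A ∩ B) := by
  by_contra! hcon
  set r : ℕ → ℝ := fun n ↦ min r₁ (1 / (n + 1)) with hr_def
  have hr0 : ∀ n, 0 < r n := fun n ↦ lt_min hr₁ Nat.one_div_pos_of_nat
  choose x hx hxη using fun n ↦ Set.not_subset.1 (hcon (r n) (hr0 n))
  choose hxA y hyx hyB using hx
  choose a ha hya using hyx
  let l : Ultrafilter ℕ := hyperfilter ℕ
  have hr : Tendsto r l (𝓝 0) := by
    refine squeeze_zero (fun n ↦ (hr0 n).le) (fun n ↦ min_le_right _ _) ?_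
    exact tendsto_one_div_add_atTop_nhds_zero_nat.mono_left Nat.hyperfilter_le_atTop
  have hcl : ∀ {C : Set (E m)} {z : ℕ → E m} {q : E m}, IsClosed C →
      (∀ n, z n ∈ Metric.cthickening (r n) C) → Tendsto z l (𝓝 q) → q ∈ C := by
    intro C z q hC hz hzq
    rw [Metric.mem_iff_infEDist_zero_of_closed hC]
    refine le_antisymm ?_ bot_le
    have h0 := ENNReal.tendsto_ofReal hr
    rw [ENNReal.ofReal_zero] at h0
    exact le_of_tendsto_of_tendsto' ((Metric.continuous_infEDist.tendsto q).comp hzq) h0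
      fun n ↦ hz n
  obtain ⟨q, -, hq⟩ : ∃ q ∈ closure (tube A B r₁), Tendsto x l (𝓝 q) :=
    hbd.isCompact_closure.ultrafilter_le_nhds' (l.map x)
      (Eventually.of_forall (f := (l : Filter ℕ)) fun n ↦ subset_closure <|
        tube_mono A B (min_le_left _ _) ⟨hxA n, y n, ⟨a n, ha n, hya n⟩, hyB n⟩)
  have hqA : q ∈ A := hcl hA hxA hq
  have hxa : Tendsto (fun n ↦ a n - x n) l (𝓝 0) := by
    refine squeeze_zero_norm (fun n ↦ ?_) (tendsto_iff_dist_tendsto_zero.1 hq)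
    rw [← dist_eq_norm, dist_comm]
    exact (ha n).2 q hqA
  have hyq : Tendsto y l (𝓝 q) := by
    have h := hq.add (hxa.const_smul (2 : ℝ))
    rw [smul_zero, add_zero] at h
    refine h.congr fun n ↦ ?_
    rw [hya, smul_sub, two_smul ℝ (x n)]
    abel
  have hqM : q ∈ A ∩ B := ⟨hqA, hcl hB hyB hyq⟩
  obtain ⟨n, hn⟩ := (hq.eventually (Metric.isOpen_thickening.mem_nhds
    (Metric.self_subset_thickening hη _ hqM))).exists
  exact hxη n hn

end RRR

theorem corollary4p3 {m : ℕ} (A B : Set (RRR.E m)) (ρ κ θ₀ : ℝ)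
    (hA_closed : IsClosed A) (hB_closed : IsClosed B)
    (hA : RRR.IsC2Submanifold A) (hB : RRR.IsC2Submanifold B)
    (h_transversal : ∀ x ∈ A ∩ B, RRR.tangentSpace A x ⊔ RRR.tangentSpace B x = ⊤)
    (hM : IsCompact (A ∩ B))
    (hθ₀ : 0 < θ₀)
    (h_angle : ∀ x ∈ A ∩ B,
      RRR.principalAngle (RRR.tangentSpace A x) (RRR.tangentSpace B x)
        ∈ Set.Icc θ₀ (Real.pi / 2))
    (hρ : 0 < ρ)
    (hA_reach : RRR.HasReachAtLeast A ρ) (hB_reach : RRR.HasReachAtLeast B ρ)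
    (hA_curv : RRR.SecondFundamentalFormBoundedBy A κ)
    (hB_curv : RRR.SecondFundamentalFormBoundedBy B κ) :
    (∃ η > 0, ∀ r ∈ Set.Ioc 0 ρ,
      RRR.NoRecurrenceIn A B (RRR.tube A B r ∩ Metric.cthickening η (A ∩ B))) ∧
    ((∃ r > 0, Bornology.IsBounded (RRR.tube A B r)) →
      ∃ r₀ ∈ Set.Ioc 0 ρ, ∀ r ∈ Set.Ioc 0 r₀, RRR.NoRecurrenceIn A B (RRR.tube A B r)) := by
  obtain ⟨η, hη, c, hc0, hc⟩ := RRR.exists_isContractingNear hA hB h_transversal hM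
  have hrec := hc.noRecurrenceIn_thickening hM hη hc0
  refine ⟨⟨η / 2, half_pos hη, fun r _ ↦ hrec.mono ?_⟩, ?_⟩
  · exact inter_subset_right.trans (Metric.cthickening_subset_thickening' hη (half_lt_self hη) _)
  · rintro ⟨r₁, hr₁, hbd⟩
    obtain ⟨r, hr, hsub⟩ := RRR.exists_tube_subset_thickening hA_closed hB_closed hr₁ hbd hη
    exact ⟨min r ρ, ⟨lt_min hr hρ, min_le_right _ _⟩, fun s hs ↦ hrec.mono
      ((RRR.tube_mono A B (hs.2.trans (min_le_left _ _))).trans hsub)⟩
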